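/- Let $n \ge 16$ and let $X \subset \mathbb{R}^n$ be a compact convex set with nonempty interior. Put $D_X = \sup_{x,x'\in X}\|x-x'\|$ (Euclidean norm) and $s_X = \max\{s \ge 0 : [-s,s]^n \subseteq X\}$. Let $\mathcal{F}_{\rm SC}$ be the class of all differentiable functions $f : X \to \mathbb{R}$ with $$f(x) \ge f(y) + \nabla f(y)^{\mathsf T}(x-y) + \tfrac12\|x-y\|^2 \qquad \text{for all } x,y \in X.$$ Let $W \sim N(0,\sigma^2)$ and $Z \sim N(0,\sigma^2 I_n)$ be independent. The first-order Gaussian (FOG) oracle answers a query $x \in X$ about $f$ with $Y = (f(x)+W, \nabla f(x)+Z)$, the gradient-only Gaussian (SOG) oracle with $Y = \nabla f(x)+Z$; the noise is independent from query to query. A $T$-step algorithm is a sequence of measurable maps $\mathcal{A}_t$, $1 \le t \le T+1$, with values in $X$; it makes the queries $X_t = \mathcal{A}_t(X_1,\dots,X_{t-1},Y_1,\dots,Y_{t-1})$, $t \le T$, receives the oracle's answers $Y_t$, and outputs $X_{T+1} = \mathcal{A}_{T+1}(X_1,\dots,X_T,Y_1,\dots,Y_T)$. For $r \ge 1$, $\varepsilon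 > 0$ and $\delta \in (0,1)$ let $K^{(r)}(\varepsilon,\delta) \in \mathbb{N}\cup\{\infty\}$ be the infimum of all $T \ge 1$ for which some $T$-step algorithm satisfies $$\sup_{f \in \mathcal{F}_{\rm SC}} \Pr\Big(\big(f(X_{T+1}) - \inf_{x\in X} f(x)\big)^r \ge \varepsilon\Big) \le \delta .$$ Then, for every $r \ge 1$, every $0 < \varepsilon \le (n s_X^2/16)^r$ and every $\delta \in (0,1/2)$, $$K^{(r)}(\varepsilon,\delta) \ge \begin{cases} \dfrac{((1-\delta)n-8)\log 2}{256\,(D_X^2+1)} \cdot \dfrac{\sigma^2}{\varepsilon^{1/r}} & \text{(FOG)},\\[2ex] \dfrac{((1-\delta)n-8)\log 2}{256} \cdot \dfrac{\sigma^2}{\varepsilon^{1/r}} & \text{(SOG)}. \end{cases}$$ -/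

import Mathlib

open MeasureTheory ProbabilityTheory Filter Topology
open scoped NNReal ENNReal

noncomputable section

namespace OracleOpt

/-- `ℝⁿ` with its Euclidean norm. -/
abbrev E (n : ℕ) : Type := EuclideanSpace ℝ (Fin n)

/-- The space of continuous real functions on a set carries its Borel `σ`-algebra
(for compact `X` the topology is that of the sup norm). -/
instance instMeasurableSpaceContinuousMap {n : ℕ} (X : Set (E n)) : MeasurableSpace C(X, ℝ) :=
  borel _

instance instBorelSpaceContinuousMap {n : ℕ} (X : Set (E n)) : BorelSpace C(X, ℝ) := ⟨rfl⟩

/-- A function on `X` as a function on the whole space (zero outside `X`), so that the calculus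
library can be applied to it, always within `X`. -/
def ext {n : ℕ} {X : Set (E n)} (f : C(X, ℝ)) : E n → ℝ := Function.extend Subtype.val f 0

/-- The gradient of `f : X → ℝ` at the point `x` of `X`. -/
def grad {n : ℕ} {X : Set (E n)} (f : C(X, ℝ)) (x : X) : E n := gradientWithin (ext f) X x

/-! ### Problem classes, algorithms, complexity -/

/-- A problem class `(X, F, O)`: a compact convex domain `X`, a class `F` of (continuous) convex
functions on `X`, and an oracle, that is, a Markov kernel `P(dy | f, x)` from `F × X` to a standard
Borel information space. -/
structure ProblemClass (n : ℕ) where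
  domain : Set (E n)
  isCompact_domain : IsCompact domain
  convex_domain : Convex ℝ domain
  instances : Set C(domain, ℝ)
  convexOn_instances : ∀ f ∈ instances, ConvexOn ℝ domain (ext f)
  Info : Type
  [measurableSpaceInfo : MeasurableSpace Info]
  [standardBorelInfo : StandardBorelSpace Info]
  oracle : Kernel (instances × domain) Info
  [isMarkovOracle : IsMarkovKernel oracle]

attribute [instance] ProblemClass.measurableSpaceInfo ProblemClass.standardBorelInfo
  ProblemClass.isMarkovOracle

namespace ProblemClass

variable {n : ℕ}

/-- The record `((x₁, y₁), …, (x_t, y_t))` of the first `t` queries and responses. -/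
abbrev History (P : ProblemClass n) (t : ℕ) : Type := Fin t → P.domain × P.Info

/-- A (deterministic) `T`-step algorithm: `next 0, …, next (T - 1)` choose the `T` queries and
`next T` chooses the candidate minimizer, each from the queries and responses made so far. -/
structure Algorithm (P : ProblemClass n) (T : ℕ) where
  next : (t : ℕ) → t ≤ T → P.History t → P.domain
  measurable_next : ∀ (t : ℕ) (h : t ≤ T), Measurable (next t h)

/-- The law of the response to the next query, given the history, when the instance is `f`. -/
def responseKernel (P : ProblemClass n) {T : ℕ} (A : P.Algorithm T) (f : P.instances) (t : ℕ)
    (h : t ≤ T) : Kernel (P.History t) P.Info :=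
  P.oracle.comap (fun H => (f, A.next t h H))
    (measurable_const.prodMk (A.measurable_next t h))

/-- The law of the first `t` queries and responses when the algorithm `A` is run on `f`. -/
def historyLaw (P : ProblemClass n) {T : ℕ} (A : P.Algorithm T) (f : P.instances) :
    (t : ℕ) → t ≤ T → Measure (P.History t)
  | 0, _ => Measure.dirac Fin.elim0
  | t + 1, h =>
      ((historyLaw P A f t (Nat.le_of_succ_le h)) ⊗ₘ
          (P.responseKernel A f t (Nat.le_of_succ_le h))).map
        (fun p => (Fin.snoc (α := fun _ => P.domain × P.Info) p.1
          (A.next t (Nat.le_of_succ_le h) p.1, p.2) : P.History (t + 1)))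

/-- The law of the candidate minimizer produced by the `T`-step algorithm `A` on `f`. -/
def outputLaw (P : ProblemClass n) {T : ℕ} (A : P.Algorithm T) (f : P.instances) :
    Measure P.domain :=
  (P.historyLaw A f T le_rfl).map (A.next T le_rfl)

/-- The error `f(x) - inf_X f` of the point `x`. -/
def err (P : ProblemClass n) (f : P.instances) (x : P.domain) : ℝ := f.1 x - ⨅ y, f.1 y

/-- The `r`th-order `(ε, δ)`-complexity: the least `T ≥ 1` for which some `T`-step algorithm has
`Pr (err ^ r ≥ ε) ≤ δ` on every instance (`⊤` if there is none). -/
def complexity (P : ProblemClass n) (r ε δ : ℝ) : ℕ∞ :=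
  sInf {K : ℕ∞ | ∃ T : ℕ, K = T ∧ 1 ≤ T ∧ ∃ A : P.Algorithm T,
    (⨆ f : P.instances, P.outputLaw A f {x | ε ≤ P.err f x ^ r}) ≤ ENNReal.ofReal δ}

end ProblemClass

/-! ### Strongly convex functions -/

/-- The differentiable functions `f : X → ℝ` that are `κ`-strongly convex:
`f x ≥ f y + ⟨∇f(y), x - y⟩ + (κ² / 2) ‖x - y‖²` for all `x, y` in `X`. -/
def stronglyConvex {n : ℕ} (X : Set (E n)) (κ : ℝ) : Set C(X, ℝ) :=
  {f | DifferentiableOn ℝ (ext f) X ∧ ∀ x y : X,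
    f y + inner ℝ (grad f y) ((x : E n) - y) + κ ^ 2 / 2 * ‖(x : E n) - y‖ ^ 2 ≤ f x}

theorem ext_apply {n : ℕ} {X : Set (E n)} (f : C(X, ℝ)) (x : X) : ext f x = f x :=
  Subtype.val_injective.extend_apply f 0 x

theorem convexOn_of_stronglyConvex {n : ℕ} {X : Set (E n)} (hX : Convex ℝ X) {κ : ℝ}
    {f : C(X, ℝ)} (hf : f ∈ stronglyConvex X κ) : ConvexOn ℝ X (ext f) := by
  refine ⟨hX, fun x hx y hy a b ha hb hab => ?_⟩
  have hz := hX hx hy ha hb hab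
  have key : ∀ w : X, f ⟨_, hz⟩ + inner ℝ (grad f ⟨_, hz⟩) ((w : E n) - (a • x + b • y)) ≤ f w :=
    fun w => le_trans (le_add_of_nonneg_right (by positivity)) (hf.2 w ⟨_, hz⟩)
  have h1 := mul_le_mul_of_nonneg_left (key ⟨x, hx⟩) ha
  have h2 := mul_le_mul_of_nonneg_left (key ⟨y, hy⟩) hb
  have e := ext_apply f ⟨_, hz⟩
  have ex := ext_apply f ⟨x, hx⟩
  have ey := ext_apply f ⟨y, hy⟩
  simp only at e ex ey h1 h2
  rw [e, ex, ey, smul_eq_mul, smul_eq_mul]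
  have h3 : a * inner ℝ (grad f ⟨_, hz⟩) (x - (a • x + b • y)) +
      b * inner ℝ (grad f ⟨_, hz⟩) (y - (a • x + b • y)) = 0 := by
    rw [← inner_smul_right, ← inner_smul_right, ← inner_add_right]
    have : a • (x - (a • x + b • y)) + b • (y - (a • x + b • y)) = 0 := by
      have hb' : b = 1 - a := by linarith
      subst hb'
      module
    rw [this, inner_zero_right]
  have h4 : a * f ⟨_, hz⟩ + b * f ⟨_, hz⟩ = f ⟨_, hz⟩ := by rw [← add_mul, hab, one_mul]
  linarith

/-- The gradient is measurable, jointly in the function and the point. -/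
theorem measurable_grad {n : ℕ} {X : Set (E n)} (hXc : IsCompact X) (hX : Convex ℝ X)
    (hXi : (interior X).Nonempty) (κ : ℝ) :
    Measurable (fun p : stronglyConvex X κ × X => grad p.1.1 p.2) := by
  have : CompactSpace X := isCompact_iff_compactSpace.mp hXc
  have hev : ∀ q : X → X, Continuous q →
      Measurable (fun p : stronglyConvex X κ × X => p.1.1 (q p.2)) := by
    intro q hq
    apply Continuous.measurable
    fun_prop
  -- directional derivatives towards a fixed point of the domain
  have hdir : ∀ z : X,
      Measurable (fun p : stronglyConvex X κ × X => inner ℝ (grad p.1.1 p.2) ((z : E n) - p.2)) := by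
    intro z
    have hmem : ∀ (k : ℕ) (x : X), (x : E n) + ((k : ℝ) + 1)⁻¹ • ((z : E n) - x) ∈ X := by
      intro k x
      refine hX.add_smul_sub_mem x.2 z.2 ⟨by positivity, ?_⟩
      exact inv_le_one_of_one_le₀ (by linarith [(Nat.cast_nonneg k : (0 : ℝ) ≤ k)])
    let q : ℕ → X → X := fun k x => ⟨_, hmem k x⟩
    have hq : ∀ k, Continuous (q k) := fun k => by
      refine Continuous.subtype_mk ?_ _
      fun_prop
    refine measurable_of_tendsto_metrizable
      (f := fun (k : ℕ) (p : stronglyConvex X κ × X) =>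
        ((k : ℝ) + 1) * (p.1.1 (q k p.2) - p.1.1 p.2)) ?_ ?_
    · intro k
      exact ((hev _ (hq k)).sub (hev id continuous_id)).const_mul _
    · rw [tendsto_pi_nhds]
      rintro ⟨f, x⟩
      have hd := (f.2.1 x x.2).hasFDerivWithinAt
      have hlim : Tendsto (fun k : ℕ => ((k : ℝ) + 1)⁻¹) atTop (𝓝 0) := by
        simpa using tendsto_one_div_add_atTop_nhds_zero_nat (𝕜 := ℝ)
      have h := hd.lim (l := atTop) (c := fun k : ℕ => (k : ℝ) + 1)
        (d := fun k : ℕ => ((k : ℝ) + 1)⁻¹ • ((z : E n) - x)) (v := (z : E n) - x)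
        (by simpa using hlim.smul_const ((z : E n) - x))
        (Eventually.of_forall fun k => hmem k x)
        (by
          refine tendsto_const_nhds.congr fun k => ?_
          rw [smul_smul, mul_inv_cancel₀ (by positivity), one_smul])
      have hg : inner ℝ (grad f.1 x) ((z : E n) - x) =
          fderivWithin ℝ (ext f.1) X x ((z : E n) - x) := by
        rw [grad, gradientWithin, InnerProductSpace.toDual_symm_apply]
      simp only
      rw [hg]
      refine h.congr fun k => ?_
      have e1 := ext_apply f.1 (q k x)
      have e2 := ext_apply f.1 x
      rw [smul_eq_mul, e2]
      exact congrArg (fun t => ((k : ℝ) + 1) * (t - f.1 x)) e1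
  obtain ⟨z, hz⟩ := hXi
  obtain ⟨ρ, hρ, hball⟩ := Metric.isOpen_iff.mp isOpen_interior z hz
  have hz' : z ∈ X := interior_subset hz
  have hzi : ∀ i : Fin n, z + EuclideanSpace.single i (ρ / 2) ∈ X := fun i => by
    apply interior_subset
    apply hball
    rw [mem_ball_iff_norm, add_sub_cancel_left, PiLp.norm_single, Real.norm_eq_abs,
      abs_of_pos (by positivity)]
    linarith
  have hcoord : ∀ i : Fin n,
      Measurable (fun p : stronglyConvex X κ × X => grad p.1.1 p.2 i) := by
    intro i
    have h := ((hdir ⟨_, hzi i⟩).sub (hdir ⟨z, hz'⟩)).const_mul (ρ / 2)⁻¹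
    have e : (fun p : stronglyConvex X κ × X => grad p.1.1 p.2 i) = fun p => (ρ / 2)⁻¹ *
        (inner ℝ (grad p.1.1 p.2) (z + EuclideanSpace.single i (ρ / 2) - (p.2 : E n)) -
          inner ℝ (grad p.1.1 p.2) (z - (p.2 : E n))) := ?_
    · rw [e]
      exact h
    funext p
    rw [← inner_sub_right, sub_sub_sub_cancel_right, add_sub_cancel_left,
      EuclideanSpace.inner_single_right]
    simp
    field_simp
  have h2 : Measurable (fun p : stronglyConvex X κ × X =>
      WithLp.toLp 2 (fun i => grad p.1.1 p.2 i)) :=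
    (WithLp.measurable_toLp 2 (Fin n → ℝ)).comp (measurable_pi_lambda _ hcoord)
  exact h2

/-! ### The Gaussian oracles -/

/-- The law `N(0, σ² Iₙ)`. -/
def vectorNoise (n : ℕ) (σ : ℝ≥0) : Measure (E n) :=
  (stdGaussian (E n)).map (fun z => (σ : ℝ) • z)

/-- The law of `(W, Z)` with `W ∼ N(0, σ²)` and `Z ∼ N(0, σ² Iₙ)` independent. -/
def fullNoise (n : ℕ) (σ : ℝ≥0) : Measure (ℝ × E n) :=
  (gaussianReal 0 (σ ^ 2)).prod (vectorNoise n σ)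

instance instIsProbabilityMeasureVectorNoise (n : ℕ) (σ : ℝ≥0) :
    IsProbabilityMeasure (vectorNoise n σ) :=
  Measure.isProbabilityMeasure_map (by fun_prop)

instance instIsProbabilityMeasureFullNoise (n : ℕ) (σ : ℝ≥0) :
    IsProbabilityMeasure (fullNoise n σ) := by
  unfold fullNoise
  infer_instance

/-- The Markov kernel that answers `a` with `u a + N`, where `N ∼ ν`. -/
def additiveNoise {α G : Type*} [MeasurableSpace α] [MeasurableSpace G] [Add G] [MeasurableAdd₂ G]
    (ν : Measure G) [IsProbabilityMeasure ν] (u : α → G) (hu : Measurable u) : Kernel α G where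
  toFun a := ν.map (fun w => u a + w)
  measurable' := by
    have hm : Measurable (fun p : α × G => u p.1 + p.2) := by fun_prop
    refine Measure.measurable_of_measurable_coe _ fun s hs => ?_
    have : ∀ a, ν.map (fun w => u a + w) s = ν (Prod.mk a ⁻¹' ((fun p : α × G => u p.1 + p.2) ⁻¹' s)) :=
      fun a => Measure.map_apply (by fun_prop) hs
    simp_rw [this]
    exact measurable_measure_prodMk_left (hm hs)

instance instIsMarkovKernelAdditiveNoise {α G : Type*} [MeasurableSpace α] [MeasurableSpace G]
    [Add G] [MeasurableAdd₂ G] (ν : Measure G) [IsProbabilityMeasure ν] (u : α → G)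
    (hu : Measurable u) : IsMarkovKernel (additiveNoise ν u hu) :=
  ⟨fun a => Measure.isProbabilityMeasure_map (μ := ν) (f := fun w => u a + w) (by fun_prop)⟩

theorem measurable_value {n : ℕ} {X : Set (E n)} (hXc : IsCompact X) (κ : ℝ) :
    Measurable (fun p : stronglyConvex X κ × X => p.1.1 p.2) := by
  have : CompactSpace X := isCompact_iff_compactSpace.mp hXc
  apply Continuous.measurable
  fun_prop

/-- The `1`-strongly convex functions on `X` with the first-order Gaussian oracle, which answers
the query `x` with `(f(x) + W, ∇f(x) + Z)`. -/
def fog {n : ℕ} (X : Set (E n)) (hXc : IsCompact X) (hX : Convex ℝ X)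
    (hXi : (interior X).Nonempty) (σ : ℝ≥0) : ProblemClass n where
  domain := X
  isCompact_domain := hXc
  convex_domain := hX
  instances := stronglyConvex X 1
  convexOn_instances _ hf := convexOn_of_stronglyConvex hX hf
  Info := ℝ × E n
  oracle := additiveNoise (fullNoise n σ) (fun p => (p.1.1 p.2, grad p.1.1 p.2))
    ((measurable_value hXc 1).prodMk (measurable_grad hXc hX hXi 1))

/-- The `1`-strongly convex functions on `X` with the gradient-only Gaussian oracle, which answers
the query `x` with `∇f(x) + Z`. -/
def sog {n : ℕ} (X : Set (E n)) (hXc : IsCompact X) (hX : Convex ℝ X)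
    (hXi : (interior X).Nonempty) (σ : ℝ≥0) : ProblemClass n where
  domain := X
  isCompact_domain := hXc
  convex_domain := hX
  instances := stronglyConvex X 1
  convexOn_instances _ hf := convexOn_of_stronglyConvex hX hf
  Info := E n
  oracle := additiveNoise (vectorNoise n σ) (fun p => grad p.1.1 p.2)
    (measurable_grad hXc hX hXi 1)

/-- `s_X`, the largest `s ≥ 0` such that the cube `[-s, s]ⁿ` lies in `X`. -/
def cubeRadius {n : ℕ} (X : Set (E n)) : ℝ :=
  sSup {s : ℝ | 0 ≤ s ∧ {x : E n | ∀ i, |x i| ≤ s} ⊆ X}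

end OracleOpt

end

/-! Optimizing to accuracy η = ε^(1/r) is at least as hard as identifying the instance within a
finite family. Take f_c(x) = ‖x − c‖²/2 with c running over vertices of a cube inside X whose sign
patterns form a Gilbert–Varshamov code (`exists_code`): the M centers satisfy log M ≥ (n/8) log 2
and 8η ≤ ‖c − c'‖² ≤ 64η when distinct (`exists_separated_centers`). By the parallelogram law no
point has error below η for two of them (`eq_of_halfSqDist_lt`), so the output of a good algorithm
names the instance with probability at least 1 − δ.

One answer says little: at every x the gradients differ by c − c' up to sign and the values by at
most D_X‖c − c'‖, so the relative entropy between two Gaussian answers is at most b = 32η/σ² (SOG)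
or 32η(D_X² + 1)/σ² (FOG). By the chain rule and data processing, T adaptive answers give at most Tb
(`relEntropyLE_outputLaw`), and Fano's inequality forces Tb ≥ (1 − δ) log M − log 2.

Only upper bounds on relative entropy are needed, so it is used in Donsker–Varadhan form: this
avoids densities on history spaces and turns each rule into the choice of a test function. -/

namespace OracleOpt

/-! ### A variational bound on the relative entropy -/

/-- The relative entropy of `μ` with respect to `ν` is at most `b`, in the variational
(Donsker–Varadhan) form. -/
def RelEntropyLE {α : Type*} [MeasurableSpace α] (μ ν : Measure α) (b : ℝ) : Prop :=
  ∀ g : α → ℝ, Measurable g → (∃ C, ∀ x, |g x| ≤ C) →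
    ∫ x, g x ∂μ ≤ b + Real.log (∫ x, Real.exp (g x) ∂ν)

theorem integrable_of_abs_le {α : Type*} [MeasurableSpace α] {μ : Measure α} [IsFiniteMeasure μ]
    {g : α → ℝ} (hg : Measurable g) {C : ℝ} (hC : ∀ x, |g x| ≤ C) : Integrable g μ :=
  Integrable.of_bound hg.aestronglyMeasurable C (ae_of_all _ hC)

theorem abs_exp_le {y C : ℝ} (h : |y| ≤ C) : |Real.exp y| ≤ Real.exp C := by
  rw [Real.abs_exp]
  exact Real.exp_le_exp.2 ((le_abs_self y).trans h)

/-- The exponential moment of a bounded function lies between two positive constants. -/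
theorem integral_exp_mem_Icc {α : Type*} [MeasurableSpace α] {μ : Measure α}
    [IsProbabilityMeasure μ] {g : α → ℝ} (hg : Measurable g) {C : ℝ} (hC : ∀ x, |g x| ≤ C) :
    ∫ x, Real.exp (g x) ∂μ ∈ Set.Icc (Real.exp (-C)) (Real.exp C) := by
  have hi : Integrable (fun x => Real.exp (g x)) μ :=
    integrable_of_abs_le hg.exp fun x => abs_exp_le (hC x)
  constructor
  · simpa using integral_mono (μ := μ) (integrable_const (Real.exp (-C))) hi
      fun x => Real.exp_le_exp.2 (neg_le_of_abs_le (hC x))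
  · simpa using integral_mono (μ := μ) hi (integrable_const (Real.exp C))
      fun x => Real.exp_le_exp.2 (le_of_abs_le (hC x))

theorem abs_log_integral_exp_le {α : Type*} [MeasurableSpace α] {μ : Measure α}
    [IsProbabilityMeasure μ] {g : α → ℝ} (hg : Measurable g) {C : ℝ} (hC : ∀ x, |g x| ≤ C) :
    |Real.log (∫ x, Real.exp (g x) ∂μ)| ≤ C := by
  obtain ⟨h1, h2⟩ := integral_exp_mem_Icc (μ := μ) hg hC
  have h0 := (Real.exp_pos (-C)).trans_le h1
  exact abs_le.2 ⟨(Real.le_log_iff_exp_le h0).2 h1, (Real.log_le_iff_le_exp h0).2 h2⟩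

namespace RelEntropyLE

variable {α β : Type*} [MeasurableSpace α] [MeasurableSpace β]

theorem mono {μ ν : Measure α} {b c : ℝ} (h : RelEntropyLE μ ν b) (hbc : b ≤ c) :
    RelEntropyLE μ ν c :=
  fun g hg hb => (h g hg hb).trans (by gcongr)

/-- The data processing inequality. -/
theorem map {μ ν : Measure α} {b : ℝ} (h : RelEntropyLE μ ν b) {φ : α → β} (hφ : Measurable φ) :
    RelEntropyLE (μ.map φ) (ν.map φ) b := by
  rintro g hg ⟨C, hC⟩
  rw [integral_map hφ.aemeasurable hg.aestronglyMeasurable,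
    integral_map hφ.aemeasurable hg.exp.aestronglyMeasurable]
  exact h _ (hg.comp hφ) ⟨C, fun x => hC _⟩

/-- The chain rule. -/
theorem compProd {μ ν : Measure α} [IsProbabilityMeasure μ] [IsProbabilityMeasure ν]
    {κ η : Kernel α β} [IsMarkovKernel κ] [IsMarkovKernel η] {b c : ℝ} (h : RelEntropyLE μ ν b)
    (hκ : ∀ a, RelEntropyLE (κ a) (η a) c) : RelEntropyLE (μ ⊗ₘ κ) (ν ⊗ₘ η) (b + c) := by
  rintro g hg ⟨C, hC⟩
  have hgs : ∀ a, Measurable fun y => g (a, y) := fun a => hg.comp measurable_prodMk_left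
  have hmP : Measurable fun a => ∫ y, g (a, y) ∂κ a :=
    hg.stronglyMeasurable.integral_kernel_prod_right'.measurable
  have hmQ : Measurable fun a => ∫ y, Real.exp (g (a, y)) ∂η a :=
    hg.exp.stronglyMeasurable.integral_kernel_prod_right'.measurable
  rw [Measure.integral_compProd (integrable_of_abs_le hg hC),
    Measure.integral_compProd (integrable_of_abs_le hg.exp fun x => abs_exp_le (hC x))]
  have hlog : ∀ a, |Real.log (∫ y, Real.exp (g (a, y)) ∂η a)| ≤ C :=
    fun a => abs_log_integral_exp_le (hgs a) fun y => hC _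
  -- The test function for the marginals is the conditional log-moment of g; its exponential
  -- integrates under ν to the full moment of g.
  have hstep := h _ hmQ.log ⟨C, hlog⟩
  have hexp : ∀ a, Real.exp (Real.log (∫ y, Real.exp (g (a, y)) ∂η a)) =
      ∫ y, Real.exp (g (a, y)) ∂η a := fun a =>
    Real.exp_log ((Real.exp_pos _).trans_le (integral_exp_mem_Icc (hgs a) fun y => hC _).1)
  simp only [hexp] at hstep
  have hint := integrable_of_abs_le (μ := μ) hmQ.log hlog
  have hbdP : ∀ a, |∫ y, g (a, y) ∂κ a| ≤ C := fun a => by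
    simpa using norm_integral_le_of_norm_le_const (μ := κ a) (f := fun y => g (a, y))
      (ae_of_all _ fun y => hC (a, y))
  calc ∫ a, ∫ y, g (a, y) ∂κ a ∂μ
      ≤ ∫ a, (c + Real.log (∫ y, Real.exp (g (a, y)) ∂η a)) ∂μ :=
        integral_mono (integrable_of_abs_le hmP hbdP) ((integrable_const c).add hint)
          fun a => hκ a _ (hgs a) ⟨C, fun y => hC _⟩
    _ = c + ∫ a, Real.log (∫ y, Real.exp (g (a, y)) ∂η a) ∂μ := by
        rw [integral_add (integrable_const c) hint]
        simp
    _ ≤ _ := by linarith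

theorem prod {μ ν : Measure α} [IsProbabilityMeasure μ] [IsProbabilityMeasure ν]
    {μ' ν' : Measure β} [IsProbabilityMeasure μ'] [IsProbabilityMeasure ν'] {b c : ℝ}
    (h : RelEntropyLE μ ν b) (h' : RelEntropyLE μ' ν' c) :
    RelEntropyLE (μ.prod μ') (ν.prod ν') (b + c) := by
  rw [← Measure.compProd_const, ← Measure.compProd_const]
  exact h.compProd fun _ => h'

/-- Base case of the inductions over coordinates and over queries. -/
theorem of_subsingleton [Subsingleton α] (μ ν : Measure α) [IsProbabilityMeasure μ]
    [IsProbabilityMeasure ν] : RelEntropyLE μ ν 0 := by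
  intro g _ _
  obtain ⟨x⟩ : Nonempty α := nonempty_of_isProbabilityMeasure μ
  have : g = fun _ => g x := funext fun y => congrArg g (Subsingleton.elim y x)
  rw [this]
  simp

theorem pi : ∀ {m : ℕ} {μ ν : Fin m → Measure α} [∀ i, IsProbabilityMeasure (μ i)]
    [∀ i, IsProbabilityMeasure (ν i)] {b : Fin m → ℝ} (_ : ∀ i, RelEntropyLE (μ i) (ν i) (b i)),
    RelEntropyLE (Measure.pi μ) (Measure.pi ν) (∑ i, b i)
  | 0, μ, ν, _, _, b, _ => by
    simpa using of_subsingleton (Measure.pi μ) (Measure.pi ν)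
  | m + 1, μ, ν, _, _, b, h => by
    have hμ := (measurePreserving_piFinSuccAbove μ 0).symm
    have hν := (measurePreserving_piFinSuccAbove ν 0).symm
    rw [← hμ.map_eq, ← hν.map_eq, Fin.sum_univ_succ]
    refine RelEntropyLE.map ?_ (MeasurableEquiv.measurable _)
    exact (h 0).prod (pi fun i => h i.succ)

/-- Change of measure followed by Jensen's inequality for exp; the log-likelihood ratio is affine
and its mean is minus the stated bound. -/
theorem gaussianReal (m m' : ℝ) {v : ℝ≥0} (hv : v ≠ 0) :
    RelEntropyLE (gaussianReal m v) (gaussianReal m' v) ((m - m') ^ 2 / (2 * v)) := by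
  rintro g hg ⟨C, hC⟩
  have hv' : (v : ℝ) ≠ 0 := by exact_mod_cast hv
  -- t x + d is the logarithm of the density of N(m', v) relative to N(m, v).
  set t : ℝ := (m' - m) / v with ht
  set d : ℝ := (m ^ 2 - m' ^ 2) / (2 * v) with hd
  have hdens : ∀ x, gaussianPDFReal m' v x = gaussianPDFReal m v x * Real.exp (t * x + d) := by
    intro x
    rw [gaussianPDFReal, gaussianPDFReal, mul_assoc _ (Real.exp _) (Real.exp _), ← Real.exp_add]
    congr 2
    rw [ht, hd]
    field_simp
    ring
  have hchange : ∫ x, Real.exp (g x) ∂(ProbabilityTheory.gaussianReal m' v) =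
      ∫ x, Real.exp (g x + (t * x + d)) ∂(ProbabilityTheory.gaussianReal m v) := by
    rw [integral_gaussianReal_eq_integral_smul hv, integral_gaussianReal_eq_integral_smul hv]
    refine integral_congr_ae (ae_of_all _ fun x => ?_)
    simp only [smul_eq_mul]
    rw [hdens, Real.exp_add (g x)]
    ring
  have hid : Integrable (fun x : ℝ => x) (ProbabilityTheory.gaussianReal m v) :=
    IsGaussian.integrable_id
  have hlin : Integrable (fun x : ℝ => t * x + d) (ProbabilityTheory.gaussianReal m v) :=
    (hid.const_mul t).add (integrable_const d)
  have hgi := integrable_of_abs_le (μ := ProbabilityTheory.gaussianReal m v) hg hC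
  have hlinint : ∫ x, (t * x + d) ∂(ProbabilityTheory.gaussianReal m v) =
      -((m - m') ^ 2 / (2 * v)) := by
    rw [integral_add (hid.const_mul t) (integrable_const d), integral_const_mul,
      integral_id_gaussianReal, integral_const]
    simp only [probReal_univ, one_smul, ht, hd]
    field_simp
    ring
  have hexpi : Integrable (fun x => Real.exp (g x + (t * x + d)))
      (ProbabilityTheory.gaussianReal m v) := by
    have h1 : Integrable (fun x => Real.exp (t * x) * Real.exp d)
        (ProbabilityTheory.gaussianReal m v) := (integrable_exp_mul_gaussianReal t).mul_const _
    have h2 := h1.bdd_mul (c := Real.exp C) hg.exp.aestronglyMeasurable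
      (ae_of_all _ fun x => abs_exp_le (hC x))
    simpa only [Real.exp_add] using h2
  have hJ := convexOn_exp.map_integral_le (μ := ProbabilityTheory.gaussianReal m v)
    Real.continuous_exp.continuousOn isClosed_univ
    (ae_of_all _ fun x => Set.mem_univ (g x + (t * x + d))) (hgi.add hlin) hexpi
  rw [integral_add hgi hlin, hlinint] at hJ
  rw [hchange]
  have := (Real.le_log_iff_exp_le ((Real.exp_pos _).trans_le hJ)).2 hJ
  linarith

end RelEntropyLE

/-! ### Gaussian noise -/

/-- Puts the law of an answer in product form, so that `RelEntropyLE.pi` applies. -/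
theorem map_const_add_vectorNoise {n : ℕ} (σ : ℝ≥0) (u : E n) :
    (vectorNoise n σ).map (fun w => u + w) =
      (Measure.pi fun i => gaussianReal (u i) (σ ^ 2)).map (WithLp.toLp 2) := by
  have h1 : ∀ i, gaussianReal (u i) (σ ^ 2) =
      (gaussianReal 0 1).map fun x => u i + (σ : ℝ) * x := by
    intro i
    have : (fun x : ℝ => u i + (σ : ℝ) * x) = (fun x => u i + x) ∘ fun x => (σ : ℝ) * x := rfl
    rw [this, ← Measure.map_map (by fun_prop) (by fun_prop), gaussianReal_map_const_mul,
      gaussianReal_map_const_add]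
    congr 1
    · simp
    · ext
      simp
  simp_rw [h1]
  rw [← Measure.pi_map_pi (fun i => by fun_prop), vectorNoise, ← map_pi_eq_stdGaussian,
    Measure.map_map (by fun_prop) (by fun_prop), Measure.map_map (by fun_prop) (by fun_prop),
    Measure.map_map (by fun_prop) (by fun_prop)]
  rfl

theorem relEntropyLE_vectorNoise {n : ℕ} {σ : ℝ≥0} (hσ : σ ≠ 0) (u v : E n) :
    RelEntropyLE ((vectorNoise n σ).map (fun w => u + w)) ((vectorNoise n σ).map (fun w => v + w))
      (‖u - v‖ ^ 2 / (2 * (σ : ℝ) ^ 2)) := by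
  rw [map_const_add_vectorNoise, map_const_add_vectorNoise]
  have h := (RelEntropyLE.pi fun i : Fin n =>
    RelEntropyLE.gaussianReal (u i) (v i) (pow_ne_zero 2 hσ)).map (WithLp.measurable_toLp 2 _)
  refine h.mono (le_of_eq ?_)
  rw [← Finset.sum_div, EuclideanSpace.norm_sq_eq]
  simp

theorem relEntropyLE_fullNoise {n : ℕ} {σ : ℝ≥0} (hσ : σ ≠ 0) (u v : ℝ × E n) :
    RelEntropyLE ((fullNoise n σ).map (fun w => u + w)) ((fullNoise n σ).map (fun w => v + w))
      (((u.1 - v.1) ^ 2 + ‖u.2 - v.2‖ ^ 2) / (2 * (σ : ℝ) ^ 2)) := by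
  have key : ∀ u : ℝ × E n, (fullNoise n σ).map (fun w => u + w) =
      (gaussianReal u.1 (σ ^ 2)).prod ((vectorNoise n σ).map (fun w => u.2 + w)) := by
    intro u
    have h0 : gaussianReal u.1 (σ ^ 2) = (gaussianReal 0 (σ ^ 2)).map (fun w => u.1 + w) := by
      rw [gaussianReal_map_const_add, zero_add]
    rw [h0, Measure.map_prod_map _ _ (by fun_prop) (by fun_prop)]
    rfl
  have hp : ∀ u : E n, IsProbabilityMeasure ((vectorNoise n σ).map (fun w => u + w)) :=
    fun u => Measure.isProbabilityMeasure_map (by fun_prop)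
  rw [key, key]
  refine ((RelEntropyLE.gaussianReal u.1 v.1 (pow_ne_zero 2 hσ)).prod
    (relEntropyLE_vectorNoise hσ u.2 v.2)).mono (le_of_eq ?_)
  push_cast
  ring

/-! ### The information gained in a run of an algorithm -/

namespace ProblemClass

variable {n : ℕ} {P : ProblemClass n} {T : ℕ}

instance instIsMarkovKernelResponseKernel (A : P.Algorithm T) (f : P.instances) (t : ℕ)
    (h : t ≤ T) : IsMarkovKernel (P.responseKernel A f t h) := by
  unfold responseKernel
  infer_instance

theorem measurable_snoc_next (A : P.Algorithm T) (t : ℕ) (h : t ≤ T) :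
    Measurable fun p : P.History t × P.Info =>
      (Fin.snoc (α := fun _ => P.domain × P.Info) p.1 (A.next t h p.1, p.2) :
        P.History (t + 1)) := by
  refine measurable_pi_lambda _ fun i => ?_
  refine Fin.lastCases ?_ (fun j => ?_) i
  · simp only [Fin.snoc_last]
    exact ((A.measurable_next t h).comp measurable_fst).prodMk measurable_snd
  · simp only [Fin.snoc_castSucc]
    exact (measurable_pi_apply j).comp measurable_fst

theorem isProbabilityMeasure_historyLaw (A : P.Algorithm T) (f : P.instances) :
    ∀ (t : ℕ) (h : t ≤ T), IsProbabilityMeasure (P.historyLaw A f t h)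
  | 0, _ => by
    rw [historyLaw]
    infer_instance
  | t + 1, h => by
    have := isProbabilityMeasure_historyLaw A f t (Nat.le_of_succ_le h)
    rw [historyLaw]
    exact Measure.isProbabilityMeasure_map (measurable_snoc_next A t _).aemeasurable

instance instIsProbabilityMeasureOutputLaw (A : P.Algorithm T) (f : P.instances) :
    IsProbabilityMeasure (P.outputLaw A f) := by
  have := isProbabilityMeasure_historyLaw A f T le_rfl
  exact Measure.isProbabilityMeasure_map (A.measurable_next T le_rfl).aemeasurable

/-- Given the history, the next query is the same under f and g, and the bound b is uniform in the
query; adaptivity therefore gains nothing, and each step adds b by the chain rule. -/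
theorem relEntropyLE_historyLaw (A : P.Algorithm T) {f g : P.instances} {b : ℝ}
    (hb : ∀ x, RelEntropyLE (P.oracle (f, x)) (P.oracle (g, x)) b) :
    ∀ (t : ℕ) (h : t ≤ T), RelEntropyLE (P.historyLaw A f t h) (P.historyLaw A g t h) (t * b)
  | 0, h => by
    have := isProbabilityMeasure_historyLaw A f 0 h
    have := isProbabilityMeasure_historyLaw A g 0 h
    simpa using RelEntropyLE.of_subsingleton (P.historyLaw A f 0 h) (P.historyLaw A g 0 h)
  | t + 1, h => by
    have := isProbabilityMeasure_historyLaw A f t (Nat.le_of_succ_le h)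
    have := isProbabilityMeasure_historyLaw A g t (Nat.le_of_succ_le h)
    rw [historyLaw, historyLaw]
    refine RelEntropyLE.map ?_ (measurable_snoc_next A t _)
    refine ((relEntropyLE_historyLaw A hb t _).compProd (c := b) fun H => ?_).mono (le_of_eq ?_)
    · exact hb _
    · push_cast
      ring

theorem relEntropyLE_outputLaw (A : P.Algorithm T) {f g : P.instances} {b : ℝ}
    (hb : ∀ x, RelEntropyLE (P.oracle (f, x)) (P.oracle (g, x)) b) :
    RelEntropyLE (P.outputLaw A f) (P.outputLaw A g) (T * b) :=
  (relEntropyLE_historyLaw A hb T le_rfl).map (A.measurable_next T le_rfl)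

end ProblemClass

/-! ### Fano's inequality -/

/-- The tangent to the logarithm at y = 1. Being linear in y, it can be summed over the hypotheses
in `fano`. -/
theorem log_one_add_le {y : ℝ} (hy : 0 ≤ y) :
    Real.log (1 + y) ≤ Real.log 2 + (y - 1) / 2 := by
  have h : Real.log ((1 + y) / 2) ≤ (1 + y) / 2 - 1 := Real.log_le_sub_one_of_pos (by positivity)
  rw [Real.log_div (by positivity) (by norm_num)] at h
  linarith

/-- Test function l · 1_s, whose exponential is 1 + (e^l − 1) 1_s. -/
theorem RelEntropyLE.mul_measureReal_le {α : Type*} [MeasurableSpace α] {μ ν : Measure α}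
    [IsProbabilityMeasure μ] [IsProbabilityMeasure ν] {b : ℝ} (h : RelEntropyLE μ ν b)
    {s : Set α} (hs : MeasurableSet s) (l : ℝ) :
    l * μ.real s ≤ b + Real.log (1 + (Real.exp l - 1) * ν.real s) := by
  have hb : ∀ x, |s.indicator (fun _ => l) x| ≤ |l| := fun x => by
    by_cases hx : x ∈ s <;> simp [hx]
  have := h (s.indicator fun _ => l) (measurable_const.indicator hs) ⟨|l|, hb⟩
  have e : (fun x => Real.exp (s.indicator (fun _ => l) x)) =
      fun x => 1 + s.indicator (fun _ => Real.exp l - 1) x := by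
    funext x
    by_cases hx : x ∈ s <;> simp [hx]
  rw [e, integral_add (integrable_const _) ((integrable_const _).indicator hs),
    integral_indicator_const _ hs, integral_indicator_const _ hs] at this
  simpa [mul_comm] using this

/-- Fano's inequality for tests between laws that are close to a common one. -/
theorem fano {α ι : Type*} [MeasurableSpace α] [Fintype ι] [Nonempty ι] {μ : ι → Measure α}
    {ν : Measure α} [∀ i, IsProbabilityMeasure (μ i)] [IsProbabilityMeasure ν] {b δ : ℝ}
    (h : ∀ i, RelEntropyLE (μ i) ν b) {s : ι → Set α} (hs : ∀ i, MeasurableSet (s i))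
    (hd : Pairwise (Function.onFun Disjoint s)) (hμ : ∀ i, 1 - δ ≤ (μ i).real (s i)) :
    (1 - δ) * Real.log (Fintype.card ι) - Real.log 2 ≤ b := by
  set M : ℝ := (Fintype.card ι : ℝ) with hM
  have hM1 : 1 ≤ M := by
    rw [hM]
    exact_mod_cast Fintype.card_pos
  have hν : ∑ i, ν.real (s i) ≤ 1 := by
    rw [← measureReal_iUnion_fintype hd hs]
    exact measureReal_le_one
  have key : ∀ i, (1 - δ) * Real.log M ≤
      b + (Real.log 2 + ((M - 1) * ν.real (s i) - 1) / 2) := fun i => by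
    have h1 := (h i).mul_measureReal_le (hs i) (Real.log M)
    rw [Real.exp_log (by linarith)] at h1
    have h2 : 0 ≤ (M - 1) * ν.real (s i) := mul_nonneg (by linarith) measureReal_nonneg
    have h3 := mul_le_mul_of_nonneg_left (hμ i) (Real.log_nonneg hM1)
    have h4 := log_one_add_le h2
    linarith
  have hsum := Finset.sum_le_sum fun i (_ : i ∈ Finset.univ) => key i
  simp only [Finset.sum_add_distrib, Finset.sum_const, Finset.card_univ, nsmul_eq_mul,
    ← Finset.sum_div, Finset.sum_sub_distrib, ← Finset.mul_sum, ← hM] at hsum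
  -- After summation the tangent corrections total at most ((M − 1) − M)/2 < 0 and can be dropped.
  have h5 : (M - 1) * ∑ i, ν.real (s i) ≤ M - 1 := mul_le_of_le_one_right (by linarith) hν
  refine le_of_mul_le_mul_left ?_ (by linarith : 0 < M)
  linarith

/-- An algorithm that tells `M` instances apart has to make enough queries. -/
theorem ProblemClass.Algorithm.fano_le {n : ℕ} {P : ProblemClass n} {T : ℕ} (A : P.Algorithm T)
    {ι : Type*} [Fintype ι] [Nonempty ι] (f : ι → P.instances) {b δ η : ℝ} (hδ : 0 ≤ δ)
    (hb : ∀ i j x, RelEntropyLE (P.oracle (f i, x)) (P.oracle (f j, x)) b)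
    (hsep : ∀ i j x, P.err (f i) x < η → P.err (f j) x < η → i = j)
    (hA : ∀ i, P.outputLaw A (f i) {x | η ≤ P.err (f i) x} ≤ ENNReal.ofReal δ) :
    (1 - δ) * Real.log (Fintype.card ι) - Real.log 2 ≤ T * b := by
  have herr : ∀ i, Measurable (P.err (f i)) := fun i =>
    ((f i).1.continuous.measurable).sub_const _
  have hms : ∀ i, MeasurableSet {x | η ≤ P.err (f i) x} := fun i =>
    measurableSet_le measurable_const (herr i)
  -- The output law of one arbitrary instance serves as the common reference; the decision regions
  -- are the sets of points with error below η.
  refine fano (μ := fun i => P.outputLaw A (f i))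
    (ν := P.outputLaw A (f (Classical.arbitrary ι))) (s := fun i => {x | η ≤ P.err (f i) x}ᶜ)
    (fun i => relEntropyLE_outputLaw A (hb i _)) (fun i => (hms i).compl) ?_ fun i => ?_
  · intro i j hij
    refine Set.disjoint_left.2 fun x hi hj => hij ?_
    exact hsep i j x (not_le.1 hi) (not_le.1 hj)
  · rw [probReal_compl_eq_one_sub (hms i)]
    have : (P.outputLaw A (f i)).real {x | η ≤ P.err (f i) x} ≤ δ :=
      ENNReal.toReal_le_of_le_ofReal hδ (hA i)
    linarith

/-! ### The Gilbert–Varshamov bound -/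

/-- The sum factors over coordinates, each contributing 1 + 1/2. -/
theorem sum_inv_two_pow_hammingDist (n : ℕ) (x : Fin n → Bool) :
    ∑ y : Fin n → Bool, (1 / 2 : ℝ) ^ hammingDist x y = (3 / 2) ^ n := by
  have h : ∀ y : Fin n → Bool,
      (1 / 2 : ℝ) ^ hammingDist x y = ∏ i, if x i ≠ y i then (1 / 2 : ℝ) else 1 := fun y => by
    rw [hammingDist, Finset.prod_ite]
    simp
  simp_rw [h]
  rw [← Fintype.prod_sum (fun i b => if x i ≠ b then (1 / 2 : ℝ) else 1)]
  have : ∀ i, ∑ b, (if x i ≠ b then (1 / 2 : ℝ) else 1) = 3 / 2 := fun i => by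
    cases x i <;> norm_num
  rw [Finset.prod_congr rfl fun i _ => this i, Finset.prod_const, Finset.card_univ,
    Fintype.card_fin]

/-- A Chernoff bound: each word counted has weight at least 2^(−n/8), while the total weight is
(3/2)^n ≤ 2^(3n/4). -/
theorem card_hammingDist_lt_le (n : ℕ) (x : Fin n → Bool) :
    ((Finset.univ.filter fun y => (hammingDist x y : ℝ) < n / 8).card : ℝ) ≤
      2 ^ (7 * n / 8 : ℝ) := by
  have h1 : ((Finset.univ.filter fun y => (hammingDist x y : ℝ) < n / 8).card : ℝ) *
      2 ^ (-(n / 8) : ℝ) ≤ (3 / 2) ^ n := by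
    rw [← sum_inv_two_pow_hammingDist n x, ← nsmul_eq_mul]
    refine (Finset.card_nsmul_le_sum _ (fun y => (1 / 2 : ℝ) ^ hammingDist x y) _
      fun y hy => ?_).trans (Finset.sum_le_sum_of_subset_of_nonneg (Finset.subset_univ _)
        fun _ _ _ => by positivity)
    rw [one_div, inv_pow, ← Real.rpow_natCast, ← Real.rpow_neg zero_le_two]
    refine Real.rpow_le_rpow_of_exponent_le one_le_two ?_
    linarith [(Finset.mem_filter.1 hy).2]
  -- Fourth powers: 81/16 ≤ 8.
  have h2 : (3 / 2 : ℝ) ≤ 2 ^ (3 / 4 : ℝ) := by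
    rw [← Real.rpow_le_rpow_iff (z := 4) (by norm_num) (by positivity) (by norm_num),
      ← Real.rpow_mul zero_le_two]
    norm_num
  have h3 : (3 / 2 : ℝ) ^ n ≤ 2 ^ (3 * n / 4 : ℝ) := by
    calc (3 / 2 : ℝ) ^ n ≤ (2 ^ (3 / 4 : ℝ)) ^ n := by gcongr
      _ = 2 ^ (3 * n / 4 : ℝ) := by
        rw [← Real.rpow_mul_natCast zero_le_two]
        congr 1
        ring
  have h4 : (2 : ℝ) ^ (7 * n / 8 : ℝ) * 2 ^ (-(n / 8) : ℝ) = 2 ^ (3 * n / 4 : ℝ) := by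
    rw [← Real.rpow_add zero_lt_two]
    congr 1
    ring
  refine le_of_mul_le_mul_right ?_ (by positivity : (0 : ℝ) < 2 ^ (-(n / 8) : ℝ))
  rw [h4]
  exact h1.trans h3

/-- There are `2 ^ (n / 8)` binary words of length `n` at mutual distances at least `n / 8`. -/
theorem exists_code {n : ℕ} (hn : 0 < n) : ∃ C : Finset (Fin n → Bool), C.Nonempty ∧
    (2 : ℝ) ^ (n / 8 : ℝ) ≤ C.card ∧
    ∀ x ∈ C, ∀ y ∈ C, x ≠ y → (n / 8 : ℝ) ≤ hammingDist x y := by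
  classical
  let S : Finset (Finset (Fin n → Bool)) := Finset.univ.filter fun C =>
    ∀ x ∈ C, ∀ y ∈ C, x ≠ y → (n / 8 : ℝ) ≤ hammingDist x y
  obtain ⟨C, hCS, hmax⟩ := S.exists_max_image Finset.card ⟨∅, by simp [S]⟩
  have hC := (Finset.mem_filter.1 hCS).2
  -- A word outside all the balls could be added to the largest code C, so the balls cover the cube,
  -- and counting gives 2^n ≤ |C| · 2^(7n/8).
  have hcover : ∀ y, ∃ x ∈ C, (hammingDist x y : ℝ) < n / 8 := by
    intro y
    by_contra! hy
    have hyC : y ∉ C := fun h => by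
      have := hy y h
      rw [hammingDist_self] at this
      have hn' : (0 : ℝ) < n := by exact_mod_cast hn
      push_cast at this
      linarith
    have hins : insert y C ∈ S := by
      refine Finset.mem_filter.2 ⟨Finset.mem_univ _, fun a ha b hb hab => ?_⟩
      rcases Finset.mem_insert.1 ha with ha | ha <;>
        rcases Finset.mem_insert.1 hb with hb | hb
      · exact absurd (ha.trans hb.symm) hab
      · rw [ha, hammingDist_comm]
        exact hy b hb
      · rw [hb]
        exact hy a ha
      · exact hC a ha b hb hab
    have := hmax _ hins
    rw [Finset.card_insert_of_notMem hyC] at this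
    omega
  have hne : C.Nonempty := by
    obtain ⟨x, hx, -⟩ := hcover fun _ => true
    exact ⟨x, hx⟩
  refine ⟨C, hne, ?_, hC⟩
  have hunion : (Finset.univ : Finset (Fin n → Bool)) ⊆
      C.biUnion fun x => Finset.univ.filter fun y => (hammingDist x y : ℝ) < n / 8 := by
    intro y _
    obtain ⟨x, hx, hxy⟩ := hcover y
    exact Finset.mem_biUnion.2 ⟨x, hx, Finset.mem_filter.2 ⟨Finset.mem_univ _, hxy⟩⟩
  have h1 : ((2 : ℝ)) ^ n ≤ ∑ x ∈ C,
      ((Finset.univ.filter fun y => (hammingDist x y : ℝ) < n / 8).card : ℝ) := by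
    have := (Finset.card_le_card hunion).trans Finset.card_biUnion_le
    rw [Finset.card_univ, Fintype.card_fun, Fintype.card_bool, Fintype.card_fin] at this
    exact_mod_cast this
  have h2 := h1.trans (Finset.sum_le_card_nsmul _ _ _ fun x _ => card_hammingDist_lt_le n x)
  rw [nsmul_eq_mul] at h2
  refine le_of_mul_le_mul_right ?_ (by positivity : (0 : ℝ) < 2 ^ (7 * n / 8 : ℝ))
  refine le_trans (le_of_eq ?_) h2
  rw [← Real.rpow_add zero_lt_two, ← Real.rpow_natCast]
  congr 1
  ring

/-! ### From distinguishable instances to complexity -/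

theorem ProblemClass.le_complexity {n : ℕ} {P : ProblemClass n} {ι : Type*} [Fintype ι]
    [Nonempty ι] (f : ι → P.instances) {b r ε δ L : ℝ} (hr : 0 < r) (hε : 0 < ε) (hδ : 0 ≤ δ)
    (hbpos : 0 < b) (hb : ∀ i j x, RelEntropyLE (P.oracle (f i, x)) (P.oracle (f j, x)) b)
    (hsep : ∀ i j x, P.err (f i) x < ε ^ (1 / r) → P.err (f j) x < ε ^ (1 / r) → i = j)
    (hL : L * b ≤ (1 - δ) * Real.log (Fintype.card ι) - Real.log 2) :
    ENNReal.ofReal L ≤ (P.complexity r ε δ : ℝ≥0∞) := by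
  have hceil : ((⌈L⌉₊ : ℕ) : ℕ∞) ≤ P.complexity r ε δ := by
    refine le_sInf ?_
    rintro K ⟨T, rfl, -, A, hA⟩
    refine Nat.cast_le.2 (Nat.ceil_le.2 (le_of_mul_le_mul_right (hL.trans ?_) hbpos))
    refine A.fano_le f hδ hb hsep fun i => le_trans (measure_mono fun x hx => ?_)
      ((le_iSup (fun g : P.instances => P.outputLaw A g {x | ε ≤ P.err g x ^ r}) (f i)).trans hA)
    change ε ≤ P.err (f i) x ^ r
    -- An error of at least ε^(1/r) has r-th power at least ε, so the failure event of `fano_le`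
    -- lies in that of the complexity.
    calc ε = (ε ^ (1 / r)) ^ r := by
          rw [← Real.rpow_mul hε.le, one_div_mul_cancel hr.ne', Real.rpow_one]
      _ ≤ _ := Real.rpow_le_rpow (by positivity) hx hr.le
  calc ENNReal.ofReal L ≤ ENNReal.ofReal (⌈L⌉₊ : ℝ) := ENNReal.ofReal_le_ofReal (Nat.le_ceil L)
    _ = (((⌈L⌉₊ : ℕ) : ℕ∞) : ℝ≥0∞) := by simp
    _ ≤ _ := ENat.toENNReal_le.2 hceil

/-! ### Quadratic functions -/

/-- Half the squared distance to `c`. -/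
noncomputable def halfSqDist {n : ℕ} (X : Set (E n)) (c : E n) : C(X, ℝ) :=
  ⟨fun x => ‖(x : E n) - c‖ ^ 2 / 2, by fun_prop⟩

section halfSqDist

variable {n : ℕ} {X : Set (E n)}

theorem halfSqDist_apply (c : E n) (x : X) :
    halfSqDist X c x = ‖(x : E n) - c‖ ^ 2 / 2 := rfl

theorem hasGradientWithinAt_halfSqDist (c : E n) (x : X) :
    HasGradientWithinAt (ext (halfSqDist X c)) ((x : E n) - c) X x := by
  have h : HasFDerivAt (fun y : E n => ‖y - c‖ ^ 2 / 2)
      (InnerProductSpace.toDual ℝ (E n) ((x : E n) - c)) x := by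
    have h1 := (((hasFDerivAt_id (x : E n)).sub_const c).norm_sq).const_mul (1 / 2 : ℝ)
    refine (h1.congr_fderiv ?_).congr_of_eventuallyEq (Eventually.of_forall fun y => ?_)
    · ext v
      simp
    · simp only [id]
      ring
  refine HasFDerivWithinAt.congr (f := fun y : E n => ‖y - c‖ ^ 2 / 2) h.hasFDerivWithinAt
    (fun y hy => ext_apply (halfSqDist X c) ⟨y, hy⟩) (ext_apply (halfSqDist X c) x)

theorem grad_halfSqDist (hX : Convex ℝ X) (hXi : (interior X).Nonempty) (c : E n) (x : X) :
    grad (halfSqDist X c) x = (x : E n) - c := by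
  rw [grad, gradientWithin, HasFDerivWithinAt.fderivWithin
    (hasGradientWithinAt_halfSqDist c x).hasFDerivWithinAt (uniqueDiffOn_convex hX hXi x x.2)]
  simp

/-- Expanding the square around y gives equality in the defining inequality. -/
theorem halfSqDist_mem_stronglyConvex (hX : Convex ℝ X) (hXi : (interior X).Nonempty) (c : E n) :
    halfSqDist X c ∈ stronglyConvex X 1 := by
  refine ⟨fun x hx => (hasGradientWithinAt_halfSqDist c
    ⟨x, hx⟩).hasFDerivWithinAt.differentiableWithinAt, fun x y => le_of_eq ?_⟩
  rw [grad_halfSqDist hX hXi, halfSqDist_apply, halfSqDist_apply]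
  have h : (x : E n) - c = ((y : E n) - c) + (x - y) := by abel
  rw [h, norm_add_sq_real]
  ring

theorem iInf_halfSqDist {c : E n} (hc : c ∈ X) : ⨅ x, halfSqDist X c x = 0 := by
  have h0 : ∀ x, 0 ≤ halfSqDist X c x := fun x => by
    rw [halfSqDist_apply]
    positivity
  have : Nonempty X := ⟨⟨c, hc⟩⟩
  refine le_antisymm ((ciInf_le ⟨0, ?_⟩ ⟨c, hc⟩).trans (le_of_eq ?_)) (le_ciInf h0)
  · rintro _ ⟨x, rfl⟩
    exact h0 x
  · simp [halfSqDist_apply]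

/-- Difference of squares: the mean of the two distances is at most the diameter, and their
difference at most ‖c − d‖. -/
theorem sq_halfSqDist_sub_le (hXc : IsCompact X) {c d : E n} (hc : c ∈ X) (hd : d ∈ X) (x : X) :
    (halfSqDist X c x - halfSqDist X d x) ^ 2 ≤ Metric.diam X ^ 2 * ‖c - d‖ ^ 2 := by
  have hdist : ∀ {c}, c ∈ X → ‖(x : E n) - c‖ ≤ Metric.diam X := fun hc => by
    rw [← dist_eq_norm]
    exact Metric.dist_le_diam_of_mem hXc.isBounded x.2 hc
  have h1 : |‖(x : E n) - c‖ - ‖(x : E n) - d‖| ≤ ‖c - d‖ := by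
    refine (abs_norm_sub_norm_le _ _).trans (le_of_eq ?_)
    rw [sub_sub_sub_cancel_left, norm_sub_rev]
  have h2 : halfSqDist X c x - halfSqDist X d x =
      ((‖(x : E n) - c‖ + ‖(x : E n) - d‖) / 2) * (‖(x : E n) - c‖ - ‖(x : E n) - d‖) := by
    rw [halfSqDist_apply, halfSqDist_apply]
    ring
  rw [h2, mul_pow, ← sq_abs (‖(x : E n) - c‖ - _)]
  gcongr
  linarith [hdist hc, hdist hd]

/-- Otherwise ‖c i − c j‖² ≤ 2‖x − c i‖² + 2‖x − c j‖² < 8η. -/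
theorem eq_of_halfSqDist_lt {ι : Type*} {c : ι → E n} {η : ℝ}
    (hsep : ∀ i j, i ≠ j → 8 * η ≤ ‖c i - c j‖ ^ 2) {i j : ι} {x : X}
    (hi : halfSqDist X (c i) x < η) (hj : halfSqDist X (c j) x < η) : i = j := by
  by_contra hij
  rw [halfSqDist_apply] at hi hj
  have h := parallelogram_law_with_norm ℝ ((x : E n) - c i) (x - c j)
  rw [sub_sub_sub_cancel_left, norm_sub_rev] at h
  nlinarith [hsep i j hij, mul_self_nonneg ‖(x : E n) - c i + (x - c j)‖]

end halfSqDist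

/-! ### Vertices of a cube -/

/-- The vertex of the cube `[-a, a]ⁿ` with the signs `θ`. -/
noncomputable def vertex {n : ℕ} (a : ℝ) (θ : Fin n → Bool) : E n :=
  WithLp.toLp 2 fun i => if θ i then a else -a

theorem norm_vertex_sub_sq {n : ℕ} (a : ℝ) (θ θ' : Fin n → Bool) :
    ‖vertex a θ - vertex a θ'‖ ^ 2 = 4 * a ^ 2 * hammingDist θ θ' := by
  have h : ∀ i, ‖(vertex a θ - vertex a θ') i‖ ^ 2 = if θ i ≠ θ' i then 4 * a ^ 2 else 0 := by
    intro i
    rw [PiLp.sub_apply, Real.norm_eq_abs, sq_abs]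
    cases h1 : θ i <;> cases h2 : θ' i <;> simp [vertex, h1, h2] <;> ring
  rw [EuclideanSpace.norm_sq_eq, Finset.sum_congr rfl fun i _ => h i, ← Finset.sum_filter,
    Finset.sum_const, nsmul_eq_mul, hammingDist, mul_comm]

theorem vertex_mem_of_le_cubeRadius {n : ℕ} {X : Set (E n)} (hXc : IsCompact X)
    {a : ℝ} (ha : 0 < a) (haX : a ≤ cubeRadius X) (θ : Fin n → Bool) : vertex a θ ∈ X := by
  -- `sSup ∅ = 0`, which 0 < a ≤ `cubeRadius X` excludes. Attainment of the supremum is not needed: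
  -- smaller vertices lie in X, and X is closed.
  have hne : {s : ℝ | 0 ≤ s ∧ {x : E n | ∀ i, |x i| ≤ s} ⊆ X}.Nonempty := by
    by_contra h
    rw [cubeRadius, Set.not_nonempty_iff_eq_empty.1 h, Real.sSup_empty] at haX
    linarith
  have hlt : ∀ t ∈ Set.Ioo 0 a, vertex t θ ∈ X := fun t ht => by
    obtain ⟨s, hs, hts⟩ := exists_lt_of_lt_csSup hne (ht.2.trans_le haX)
    refine hs.2 fun i => ?_
    have : |vertex t θ i| = t := by
      by_cases h : θ i <;> simp [vertex, h, abs_of_pos ht.1]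
    linarith
  have hcont : Continuous fun t : ℝ => vertex t θ := by
    refine (PiLp.continuous_toLp 2 _).comp (continuous_pi fun i => ?_)
    split_ifs <;> fun_prop
  have hcl : a ∈ closure (Set.Ioo 0 a) := by
    rw [closure_Ioo ha.ne]
    exact ⟨ha.le, le_rfl⟩
  exact hXc.isClosed.closure_subset (map_mem_closure (f := fun t : ℝ => vertex t θ) hcont hcl hlt)

/-- With a² = 16η/n, squared distances are (64η/n) times Hamming distances, which lie in [n/8, n]
for distinct codewords; the bound on η says a ≤ s_X. -/
theorem exists_separated_centers {n : ℕ} (hn : 0 < n) {X : Set (E n)} (hXc : IsCompact X)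
    {η : ℝ} (hη : 0 < η) (hηX : η ≤ n * cubeRadius X ^ 2 / 16) :
    ∃ (C : Finset (Fin n → Bool)) (c : C → E n), Nonempty C ∧
      n / 8 * Real.log 2 ≤ Real.log (Fintype.card C) ∧ (∀ i, c i ∈ X) ∧
      (∀ i j, ‖c i - c j‖ ^ 2 ≤ 64 * η) ∧ ∀ i j, i ≠ j → 8 * η ≤ ‖c i - c j‖ ^ 2 := by
  obtain ⟨C, hne, hcard, hC⟩ := exists_code hn
  have hn' : (0 : ℝ) < n := by exact_mod_cast hn
  have hsq : √(16 * η / n) ^ 2 = 16 * η / n := Real.sq_sqrt (by positivity)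
  have hX0 : 0 ≤ cubeRadius X := Real.sSup_nonneg fun s hs => hs.1
  have hle : √(16 * η / n) ≤ cubeRadius X := by
    rw [Real.sqrt_le_left hX0, div_le_iff₀ hn']
    linarith
  have hdist : ∀ θ θ' : Fin n → Bool,
      ‖vertex √(16 * η / n) θ - vertex √(16 * η / n) θ'‖ ^ 2 = 64 * η / n * hammingDist θ θ' :=
    fun θ θ' => by
      rw [norm_vertex_sub_sq, hsq]
      ring
  refine ⟨C, fun θ => vertex √(16 * η / n) θ, hne.to_subtype, ?_,
    fun θ => vertex_mem_of_le_cubeRadius hXc (by positivity) hle _, fun θ θ' => ?_,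
    fun θ θ' h => ?_⟩
  · rw [← Real.log_rpow zero_lt_two, Fintype.card_coe]
    exact Real.log_le_log (by positivity) hcard
  · rw [hdist]
    have : (hammingDist (θ : Fin n → Bool) θ' : ℝ) ≤ n := by
      exact_mod_cast hammingDist_le_card_fintype.trans (Fintype.card_fin n).le
    calc 64 * η / n * (hammingDist (θ : Fin n → Bool) θ' : ℝ) ≤ 64 * η / n * n := by gcongr
      _ = 64 * η := by field_simp
  · rw [hdist]
    have := hC θ θ.2 θ' θ'.2 fun e => h (Subtype.ext e)
    calc 8 * η = 64 * η / n * (n / 8) := by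
          field_simp
          norm_num
      _ ≤ _ := by gcongr

end OracleOpt

/-! ### The lower bounds for both oracles -/

open OracleOpt in
theorem theorem3 {n : ℕ} (hn : 16 ≤ n) (X : Set (OracleOpt.E n)) (hXc : IsCompact X)
    (hX : Convex ℝ X) (hXi : (interior X).Nonempty) (σ : ℝ≥0) (r ε δ : ℝ) (hr : 1 ≤ r)
    (hε : 0 < ε) (hεX : ε ≤ (n * OracleOpt.cubeRadius X ^ 2 / 16) ^ r)
    (hδ : 0 < δ) (hδ' : δ < 1 / 2) :
    ENNReal.ofReal (((1 - δ) * n - 8) * Real.log 2 / (256 * (Metric.diam X ^ 2 + 1)) *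
        ((σ : ℝ) ^ 2 / ε ^ (1 / r))) ≤
      ((OracleOpt.fog X hXc hX hXi σ).complexity r ε δ : ℝ≥0∞) ∧
    ENNReal.ofReal (((1 - δ) * n - 8) * Real.log 2 / 256 * ((σ : ℝ) ^ 2 / ε ^ (1 / r))) ≤
      ((OracleOpt.sog X hXc hX hXi σ).complexity r ε δ : ℝ≥0∞) := by
  -- Without noise both lower bounds are 0; the entropy bounds need σ ≠ 0.
  rcases eq_or_ne σ 0 with rfl | hσ
  · simp
  have hσ' : (0 : ℝ) < σ := by exact_mod_cast pos_iff_ne_zero.2 hσ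
  have hr0 : 0 < r := by linarith
  have hη : 0 < ε ^ (1 / r) := by positivity
  have hηX : ε ^ (1 / r) ≤ n * cubeRadius X ^ 2 / 16 := by
    calc ε ^ (1 / r) ≤ ((n * cubeRadius X ^ 2 / 16) ^ r) ^ (1 / r) :=
          Real.rpow_le_rpow hε.le hεX (by positivity)
      _ = _ := by
          rw [← Real.rpow_mul (by positivity), mul_one_div_cancel hr0.ne', Real.rpow_one]
  obtain ⟨C, c, hC, hcard, hcX, hclose, hsep⟩ :=
    exists_separated_centers (by omega) hXc hη hηX
  set η := ε ^ (1 / r) with hηdef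
  have hinfo : ((1 - δ) * n - 8) * Real.log 2 / 8 ≤
      (1 - δ) * Real.log (Fintype.card C) - Real.log 2 := by
    have := mul_le_mul_of_nonneg_left hcard (by linarith : 0 ≤ 1 - δ)
    linarith
  let f : C → stronglyConvex X 1 := fun i => ⟨_, halfSqDist_mem_stronglyConvex hX hXi (c i)⟩
  have hgrad : ∀ i j (x : X), ‖grad (f i).1 x - grad (f j).1 x‖ ^ 2 ≤ 64 * η := fun i j x => by
    rw [grad_halfSqDist hX hXi, grad_halfSqDist hX hXi, sub_sub_sub_cancel_left]
    exact hclose j i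
  have herr : ∀ i (x : X), (f i).1 x - ⨅ y, (f i).1 y = halfSqDist X (c i) x := fun i x => by
    change halfSqDist X (c i) x - ⨅ y, halfSqDist X (c i) y = _
    rw [iInf_halfSqDist (hcX i), sub_zero]
  have hident : ∀ i j (x : X), (f i).1 x - ⨅ y, (f i).1 y < η →
      (f j).1 x - ⨅ y, (f j).1 y < η → i = j := fun i j x hi hj => by
    rw [herr] at hi hj
    exact eq_of_halfSqDist_lt hsep hi hj
  constructor
  · refine ProblemClass.le_complexity (P := fog X hXc hX hXi σ) f hr0 hε hδ.le
      -- The values contribute 64η D_X² and the gradients 64η. Dividing by 2σ² leaves a factor 32,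
      -- and the 8 in `hinfo` makes it 256.
      (b := 64 * η * (Metric.diam X ^ 2 + 1) / (2 * (σ : ℝ) ^ 2)) (by positivity)
      (fun i j x => ?_) hident (le_trans (le_of_eq ?_) hinfo)
    · refine (relEntropyLE_fullNoise hσ ((f i).1 x, grad (f i).1 x)
        ((f j).1 x, grad (f j).1 x)).mono ?_
      have h1 := (sq_halfSqDist_sub_le hXc (hcX i) (hcX j) x).trans
        (mul_le_mul_of_nonneg_left (hclose i j) (sq_nonneg _))
      have h2 := hgrad i j x
      gcongr
      calc _ ≤ Metric.diam X ^ 2 * (64 * η) + 64 * η := add_le_add h1 h2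
        _ = _ := by ring
    · field_simp
      ring
  · refine ProblemClass.le_complexity (P := sog X hXc hX hXi σ) f hr0 hε hδ.le
      (b := 64 * η / (2 * (σ : ℝ) ^ 2)) (by positivity)
      (fun i j x => ?_) hident (le_trans (le_of_eq ?_) hinfo)
    · refine (relEntropyLE_vectorNoise hσ (grad (f i).1 x) (grad (f j).1 x)).mono ?_
      have h2 := hgrad i j x
      gcongr
    · field_simp
      ring
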